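/- Let $m\ge 0$ and let $R(z)\in\mathbb{C}(z)^{m\times m}$ be a rational matrix. For a rational matrix, $R^*$ denotes the rational matrix obtained by transposing $R$ and conjugating the coefficients of its entries, so $R^*(z)=\overline{R(\overline z)}^{\,T}$; call $R$ *para-Hermitian* (resp. *para-skew-Hermitian*) if $R^*(1/z)=R(z)$ (resp. $R^*(1/z)=-R(z)$). A *linear system matrix* with *transfer function* $H(z)\in\mathbb{C}(z)^{m\times m}$ is a partitioned pencil $$L(z)=zL_1+L_0=\begin{bmatrix}-A(z)&B(z)\\ C(z)&D(z)\end{bmatrix},\qquad L_0,L_1\in\mathbb{C}^{(n+m)\times(n+m)},$$ where $A(z)=zA_1-A_0$ is $n\times n$ for some $n\ge 0$, $D(z)$ is $m\times m$, $\det A(z)\not\equiv0$, and $H(z)=D(z)+C(z)A(z)^{-1}B(z)$. Let $B_1$ and $C_1$ be the coefficients of $z$ in $B(z)$ and $C(z)$. The pencil $L$ is a *strongly minimal linearization* of $H$ if, moreover, $$\operatorname{rank}\begin{bmatrix}-A(z_0)&B(z_0)\end{bmatrix}=\operatorname{rank}\begin{bmatrix}-A(z_0)\\ C(z_0)\end{bmatrix}=n\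 \text{ for all } z_0\in\mathbb{C},\qquad \operatorname{rank}\begin{bmatrix}-A_1&B_1\end{bmatrix}=\operatorname{rank}\begin{bmatrix}-A_1\\ C_1\end{bmatrix}=n .$$ The pencil $L$ is *$*$-palindromic* (resp. *$*$-anti-palindromic*) if $z\,L^*(1/z)=L(z)$ (resp. $z\,L^*(1/z)=-L(z)$), that is, $L_1=L_0^*$ (resp. $L_1=-L_0^*$), where for a constant matrix $^*$ is the conjugate transpose. **Theorem.** $R(z)$ is para-Hermitian (resp. para-skew-Hermitian) if and only if there exists a strongly minimal $*$-palindromic (resp. $*$-anti-palindromic) linearization of $(1+z)R(z)$. -/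

import Mathlib

/-- The para-conjugate `f ↦ f^*(1/z)` of a rational function: the coefficients of `f` are replaced
by their complex conjugates and the variable `z` by `1/z`. At points, this is
`z ↦ conj (f (1 / conj z))`. -/
noncomputable def paraConj (f : RatFunc ℂ) : RatFunc ℂ :=
  RatFunc.eval ((RatFunc.C : ℂ →+* RatFunc ℂ).comp (starRingEnd ℂ)) (RatFunc.X)⁻¹ f

/-- A square rational matrix is para-Hermitian if `R(z)_{ij} = conj (R(1 / conj z)_{ji})`. -/
def IsParaHermitian {m : ℕ} (R : Matrix (Fin m) (Fin m) (RatFunc ℂ)) : Prop :=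
  ∀ i j, R i j = paraConj (R j i)

/-- A square rational matrix is para-skew-Hermitian if
`R(z)_{ij} = - conj (R(1 / conj z)_{ji})`. -/
def IsParaSkewHermitian {m : ℕ} (R : Matrix (Fin m) (Fin m) (RatFunc ℂ)) : Prop :=
  ∀ i j, R i j = -paraConj (R j i)

/-- A square pencil `L(t) = t L₁ + L₀`, of size `n + m`, partitioned as
`[-A(t), B(t); C(t), D(t)]` with `A(t)` of size `n` and `D(t)` of size `m`. -/
@[ext]
structure BlockPencil (n m : ℕ) where
  /-- the coefficient of `t` -/
  L₁ : Matrix (Fin n ⊕ Fin m) (Fin n ⊕ Fin m) ℂ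
  /-- the constant coefficient -/
  L₀ : Matrix (Fin n ⊕ Fin m) (Fin n ⊕ Fin m) ℂ

namespace BlockPencil

variable {n m : ℕ}

/-- The value `L(t₀)` at a complex number. -/
def eval (L : BlockPencil n m) (t₀ : ℂ) : Matrix (Fin n ⊕ Fin m) (Fin n ⊕ Fin m) ℂ :=
  t₀ • L.L₁ + L.L₀

/-- `L(t)` as a matrix over the field of rational functions. -/
noncomputable def toRat (L : BlockPencil n m) :
    Matrix (Fin n ⊕ Fin m) (Fin n ⊕ Fin m) (RatFunc ℂ) :=
  (RatFunc.X : RatFunc ℂ) • L.L₁.map RatFunc.C + L.L₀.map RatFunc.C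

/-- The state matrix `A(t)`: minus the upper left block. -/
noncomputable def A (L : BlockPencil n m) : Matrix (Fin n) (Fin n) (RatFunc ℂ) :=
  -L.toRat.toBlocks₁₁

/-- The upper right block `B(t)`. -/
noncomputable def B (L : BlockPencil n m) : Matrix (Fin n) (Fin m) (RatFunc ℂ) :=
  L.toRat.toBlocks₁₂

/-- The lower left block `C(t)`. -/
noncomputable def C (L : BlockPencil n m) : Matrix (Fin m) (Fin n) (RatFunc ℂ) :=
  L.toRat.toBlocks₂₁

/-- The lower right block `D(t)`. -/
noncomputable def D (L : BlockPencil n m) : Matrix (Fin m) (Fin m) (RatFunc ℂ) :=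
  L.toRat.toBlocks₂₂

/-- `L(t)` is a linear system matrix with transfer function `H(t)`: the block `A(t)` is regular and
`H(t) = D(t) + C(t) A(t)⁻¹ B(t)`. -/
def IsLinearSystemMatrixOf (L : BlockPencil n m) (H : Matrix (Fin m) (Fin m) (RatFunc ℂ)) : Prop :=
  L.A.det ≠ 0 ∧ H = L.D + L.C * L.A⁻¹ * L.B

/-- Minimality at all finite points: `[-A(t₀), B(t₀)]` has full row rank and `[-A(t₀); C(t₀)]` has
full column rank, for every `t₀ ∈ ℂ`. -/
def IsMinimal (L : BlockPencil n m) : Prop :=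
  ∀ t₀ : ℂ, (L.eval t₀).toRows₁.rank = n ∧ (L.eval t₀).toCols₁.rank = n

/-- Minimality at infinity: the same rank conditions on the coefficient of `t`. -/
def IsMinimalAtInfinity (L : BlockPencil n m) : Prop :=
  L.L₁.toRows₁.rank = n ∧ L.L₁.toCols₁.rank = n

/-- `L(t)` is a strongly minimal linearization of `H(t)`. -/
def IsStronglyMinimalLinearizationOf (L : BlockPencil n m)
    (H : Matrix (Fin m) (Fin m) (RatFunc ℂ)) : Prop :=
  L.IsLinearSystemMatrixOf H ∧ L.IsMinimal ∧ L.IsMinimalAtInfinity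

/-- `L^*(t)`: the coefficients are replaced by their conjugate transposes. -/
def conjCoeff (L : BlockPencil n m) : BlockPencil n m := ⟨L.L₁.conjTranspose, L.L₀.conjTranspose⟩

/-- The reversal `t L(1/t)` of a pencil. The exponent is `1` also if the coefficient of `t` is
zero. -/
def rev (L : BlockPencil n m) : BlockPencil n m := ⟨L.L₀, L.L₁⟩

/-- The pencil `-L(t)`. -/
def neg (L : BlockPencil n m) : BlockPencil n m := ⟨-L.L₁, -L.L₀⟩

/-- `L` is `*`-palindromic: `rev L^* = L`. -/
def IsStarPalindromic (L : BlockPencil n m) : Prop := L.conjCoeff.rev = L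

/-- `L` is `*`-anti-palindromic: `rev L^* = -L`. -/
def IsStarAntiPalindromic (L : BlockPencil n m) : Prop := L.conjCoeff.rev = L.neg

end BlockPencil

/-! Write `F^#` for the para-conjugate transpose of `F`. Since `X (1 + X)^# = 1 + X`, the matrix `R`
is para-Hermitian iff `H = (1 + X) R` satisfies `X H^# = H`. A palindromic pencil `M` satisfies `X
M^# = M`, and `H = Z^# M Z` with `Z = [A⁻¹B; 1]`, so transfer functions of palindromic pencils have
this symmetry (`IsRealization.smul_conj_eq`).

Conversely, write `H = G + X G^#` with `G = H / 2`. Any realization of `G` and its conjugate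
reversal combine into a palindromic realization of `H` (`exists_palindromic_realization`), and one
with the fewest states is strongly minimal. Indeed, if a rank condition fails at a point of the
projective line, a null vector makes one state's row a scalar multiple of a constant row. A
congruence turns the latter into a coordinate vector, by palindromicity the column has the same
shape, and at least one state can be deleted symmetrically (`IsRealization.exists_card_lt`).

The skew case follows on multiplying by `±i`. -/

/-! ### Para-conjugation as an involution of the field of rational functions. -/

lemma eval₂_conj_X_inv_injective :
    Function.Injective (Polynomial.eval₂RingHom
      ((RatFunc.C : ℂ →+* RatFunc ℂ).comp (starRingEnd ℂ)) (RatFunc.X)⁻¹) := by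
  rw [injective_iff_map_eq_zero]
  intro p hp
  by_contra hne
  -- As `1/X` is transcendental, no nonzero denominator evaluates to zero. Hence the quotient in
  -- `RatFunc.eval` never takes its default value, and para-conjugation is multiplicative and
  -- additive.
  have hX : Transcendental ℂ (RatFunc.X : RatFunc ℂ) := RatFunc.transcendental_X
  apply hX
  have : IsAlgebraic ℂ ((RatFunc.X : RatFunc ℂ)⁻¹) := by
    refine ⟨p.map (starRingEnd ℂ), ?_, ?_⟩
    · rwa [Ne, Polynomial.map_eq_zero]
    · rw [Polynomial.aeval_def, Polynomial.eval₂_map]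
      exact hp
  simpa using this.inv

/-- The para-conjugation as a ring homomorphism. -/
noncomputable def paraConjHom : RatFunc ℂ →+* RatFunc ℂ :=
  RatFunc.liftRingHom (Polynomial.eval₂RingHom
      ((RatFunc.C : ℂ →+* RatFunc ℂ).comp (starRingEnd ℂ)) (RatFunc.X)⁻¹)
    (nonZeroDivisors_le_comap_nonZeroDivisors_of_injective _ eval₂_conj_X_inv_injective)

lemma paraConj_eq_paraConjHom (f : RatFunc ℂ) : paraConj f = paraConjHom f := by
  rw [paraConjHom, RatFunc.liftRingHom_apply]
  rfl

@[simp]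
lemma paraConjHom_C (c : ℂ) : paraConjHom (RatFunc.C c) = RatFunc.C (star c) := by
  rw [← paraConj_eq_paraConjHom, paraConj, RatFunc.eval_C]
  rfl

@[simp]
lemma paraConjHom_X : paraConjHom RatFunc.X = (RatFunc.X)⁻¹ := by
  rw [← paraConj_eq_paraConjHom, paraConj, RatFunc.eval_X]

lemma paraConjHom_paraConjHom (f : RatFunc ℂ) : paraConjHom (paraConjHom f) = f := by
  have : paraConjHom.comp paraConjHom = RingHom.id _ := by
    apply IsLocalization.ringHom_ext (nonZeroDivisors (Polynomial ℂ))
    apply Polynomial.ringHom_ext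
    · intro a
      simp [RatFunc.algebraMap_C]
    · simp [RatFunc.algebraMap_X]
  exact congrArg (fun g : RatFunc ℂ →+* RatFunc ℂ => g f) this

/-! ### Transfer functions without inverses; change of states and deletion of states. -/

open Matrix in
/-- `H` is the transfer function of the regular system matrix `M`, whose states are indexed
by `ι`: no nonzero vector supported on the states is mapped into the outputs, and the equation
`M [Z; 1] = [0; H]` has a solution. -/
def IsRealization {ι μ K : Type} [Fintype ι] [Fintype μ] [DecidableEq μ] [Field K]
    (M : Matrix (ι ⊕ μ) (ι ⊕ μ) K) (H : Matrix μ μ K) : Prop :=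
  (∀ w : ι ⊕ μ → K, (∀ a, w (Sum.inr a) = 0) → (∀ i, (M *ᵥ w) (Sum.inl i) = 0) → w = 0) ∧
    ∃ Z : Matrix (ι ⊕ μ) μ K, Z.toRows₂ = 1 ∧ M * Z = fromRows 0 H

section Realization

open Matrix

variable {ι μ K : Type} [Fintype ι] [Fintype μ] [DecidableEq ι] [DecidableEq μ] [Field K]

omit [DecidableEq μ] in
lemma forall_state_eq_zero_iff_det_ne_zero (A : Matrix ι ι K) (B : Matrix ι μ K)
    (C : Matrix μ ι K) (D : Matrix μ μ K) :
    (∀ w : ι ⊕ μ → K, (∀ a, w (Sum.inr a) = 0) →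
      (∀ i, (fromBlocks (-A) B C D *ᵥ w) (Sum.inl i) = 0) → w = 0) ↔ A.det ≠ 0 := by
  rw [Ne, ← exists_mulVec_eq_zero_iff]
  push Not
  constructor
  · intro h v hv hv0
    apply hv
    have := h (Sum.elim v 0) (fun _ => rfl) (fun i => by
      simp [fromBlocks_mulVec, Matrix.neg_mulVec, hv0])
    ext i
    exact congrFun this (Sum.inl i)
  · intro h w hw hw0
    by_contra hne
    refine h (w ∘ Sum.inl) (fun h0 => hne ?_) ?_
    · ext (i | a)
      · exact congrFun h0 i
      · exact hw a
    · have hr : w ∘ Sum.inr = 0 := funext hw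
      ext i
      have := hw0 i
      rw [fromBlocks_mulVec] at this
      simpa [hr, Matrix.neg_mulVec] using this

lemma isRealization_fromBlocks_iff (A : Matrix ι ι K) (B : Matrix ι μ K) (C : Matrix μ ι K)
    (D : Matrix μ μ K) (H : Matrix μ μ K) :
    IsRealization (fromBlocks (-A) B C D) H ↔ A.det ≠ 0 ∧ H = D + C * A⁻¹ * B := by
  rw [IsRealization, forall_state_eq_zero_iff_det_ne_zero]
  refine and_congr_right fun hA => ?_
  have hu : IsUnit A.det := isUnit_iff_ne_zero.mpr hA
  constructor
  · rintro ⟨Z, hZ, hM⟩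
    rw [← fromRows_toRows Z, hZ, fromBlocks_mul_fromRows] at hM
    obtain ⟨h1, h2⟩ := fromRows_inj.eq_iff.mp hM |> fun h => (h : _ ∧ _)
    have : Z.toRows₁ = A⁻¹ * B := by
      rw [Matrix.mul_one, Matrix.neg_mul, neg_add_eq_zero] at h1
      rw [← h1, ← Matrix.mul_assoc, nonsing_inv_mul _ hu, Matrix.one_mul]
    rw [← h2, this, Matrix.mul_assoc, Matrix.mul_one, add_comm]
  · intro h
    refine ⟨fromRows (A⁻¹ * B) 1, toRows₂_fromRows .., ?_⟩
    rw [fromBlocks_mul_fromRows, Matrix.neg_mul, ← Matrix.mul_assoc, mul_nonsing_inv _ hu, h,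
      Matrix.mul_assoc, add_comm D]
    simp

/-- Invertible changes of the states, with additions of states to inputs and outputs, leave the
transfer function unchanged. -/
lemma IsRealization.conj {M T U V W : Matrix (ι ⊕ μ) (ι ⊕ μ) K} {H : Matrix μ μ K}
    (h : IsRealization M H) (hTU : T * U = 1) (hWV : W * V = 1)
    (hT' : ∀ a k, T (Sum.inr a) k = (1 : Matrix (ι ⊕ μ) (ι ⊕ μ) K) (Sum.inr a) k)
    (hV' : ∀ k a, V k (Sum.inr a) = (1 : Matrix (ι ⊕ μ) (ι ⊕ μ) K) k (Sum.inr a)) :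
    IsRealization (V * M * T) H := by
  have hUT : U * T = 1 := mul_eq_one_comm.mp hTU
  have hVW : V * W = 1 := mul_eq_one_comm.mp hWV
  -- `V`, hence also `W`, is block lower triangular: state equations of `M` are combinations of
  -- state equations of `V * M * T`.
  have hW' (i a) : W (Sum.inl i) (Sum.inr a) = 0 := by
    have := congrFun (congrFun hWV (Sum.inl i)) (Sum.inr a)
    simpa [mul_apply, hV', one_apply] using this
  obtain ⟨hreg, Z, hZ, hM⟩ := h
  constructor
  · intro w hw hw0
    have h1 : T *ᵥ w = 0 := by
      apply hreg
      · intro a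
        simp only [mulVec, dotProduct, hT']
        simp [one_apply, hw]
      · intro i
        have h2 : M *ᵥ (T *ᵥ w) = W *ᵥ ((V * M * T) *ᵥ w) := by
          simp only [mulVec_mulVec]
          rw [Matrix.mul_assoc V, ← Matrix.mul_assoc W, hWV, Matrix.one_mul]
        rw [h2, mulVec, dotProduct, Fintype.sum_sum_type]
        simp [hw0, hW']
    rw [← one_mulVec w, ← hUT, ← mulVec_mulVec, h1, mulVec_zero]
  · refine ⟨U * Z, ?_, ?_⟩
    · have h3 : (T * (U * Z)).toRows₂ = (U * Z).toRows₂ := by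
        ext a j
        simp only [toRows₂_apply, mul_apply, hT']
        simp [one_apply]
      rw [← h3, ← Matrix.mul_assoc, hTU, Matrix.one_mul, hZ]
    · rw [Matrix.mul_assoc, ← Matrix.mul_assoc T, hTU, Matrix.one_mul, Matrix.mul_assoc, hM]
      ext i j
      rw [mul_apply, Fintype.sum_sum_type]
      simp only [fromRows_apply_inl, fromRows_apply_inr, Matrix.zero_apply, mul_zero,
        Finset.sum_const_zero, zero_add, hV']
      rcases i with i | i <;> simp [one_apply]

omit [DecidableEq ι] in
lemma IsRealization.reindex {ι' : Type} [Fintype ι'] (e : ι' ≃ ι)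
    {M : Matrix (ι ⊕ μ) (ι ⊕ μ) K} {H : Matrix μ μ K} (h : IsRealization M H) :
    IsRealization (M.submatrix (Sum.map e id) (Sum.map e id)) H := by
  have he : (Sum.map e id : ι' ⊕ μ → ι ⊕ μ) = Equiv.sumCongr e (Equiv.refl μ) := by
    ext (i | i) <;> rfl
  rw [he]
  set f := Equiv.sumCongr e (Equiv.refl μ)
  obtain ⟨hreg, Z, hZ, hM⟩ := h
  constructor
  · intro w hw hw0
    rw [submatrix_mulVec_equiv] at hw0
    have := hreg (w ∘ f.symm) (fun a => hw a) (fun i => by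
      simpa [f] using hw0 (e.symm i))
    ext k
    simpa using congrFun this (f k)
  · refine ⟨Z.submatrix f id, ?_, ?_⟩
    · rw [← hZ]
      rfl
    · rw [submatrix_mul_equiv, hM]
      ext (i | i) j <;> rfl

/-- If the row of a state `i` and the column of `i` are supported at the state `j`, then the states
`i` and `j` can be deleted. -/
lemma IsRealization.delete {M : Matrix (ι ⊕ μ) (ι ⊕ μ) K} {H : Matrix μ μ K}
    (h : IsRealization M H) {i j : ι} {p q : K} (hp : p ≠ 0) (hq : q ≠ 0)
    (hrow : ∀ k, M (Sum.inl i) k = if k = Sum.inl j then p else 0)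
    (hcol : ∀ k, M k (Sum.inl i) = if k = Sum.inl j then q else 0) :
    IsRealization (M.submatrix (Sum.map (Subtype.val : {k : ι // k ≠ i ∧ k ≠ j} → ι) id)
      (Sum.map (Subtype.val : {k : ι // k ≠ i ∧ k ≠ j} → ι) id)) H := by
  classical
  have hsum (r : ι ⊕ μ) (hr : r ≠ Sum.inl j) (g : ι ⊕ μ → K) (hg : g (Sum.inl j) = 0) :
      ∑ k : {k : ι // k ≠ i ∧ k ≠ j} ⊕ μ, M r (Sum.map Subtype.val id k) *
        g (Sum.map Subtype.val id k) = ∑ k, M r k * g k := by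
    rw [Fintype.sum_sum_type, Fintype.sum_sum_type]
    congr 1
    simp only [Sum.map_inl]
    rw [← Finset.sum_subtype (Finset.univ.filter fun k => k ≠ i ∧ k ≠ j) (by simp)
      (fun k => M r (Sum.inl k) * g (Sum.inl k)), Finset.sum_filter_of_ne]
    intro k _ hk
    constructor
    · rintro rfl
      exact hk (by rw [hcol, if_neg hr, zero_mul])
    · rintro rfl
      exact hk (by rw [hg, mul_zero])
  have hrow' (g : ι ⊕ μ → K) : ∑ k, M (Sum.inl i) k * g k = p * g (Sum.inl j) := by
    simp [hrow]
  obtain ⟨hreg, Z, hZ, hM⟩ := h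
  constructor
  · intro w hw hw0
    let g : ι ⊕ μ → K := Sum.elim (fun k => if h : k ≠ i ∧ k ≠ j then w (Sum.inl ⟨k, h⟩) else 0) 0
    have hgw (k) : g (Sum.map Subtype.val id k) = w k := by
      rcases k with k | a
      · simp [g, k.2.1, k.2.2]
      · simp [g, hw]
    have hgj : g (Sum.inl j) = 0 := by simp [g]
    -- State `i` enters only equation `j`, so its value can be chosen to satisfy that equation;
    -- equation `i` only says that state `j` vanishes. The case `i = j` is included.
    let t := -(M *ᵥ g) (Sum.inl j) / q
    have key : g + Pi.single (Sum.inl i) t = 0 := by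
      apply hreg
      · intro a
        simp [g]
      · intro k
        rw [mulVec_add, Pi.add_apply, mulVec_single]
        simp only [Pi.smul_apply, col_apply, MulOpposite.smul_eq_mul_unop, MulOpposite.unop_op,
          hcol, Sum.inl.injEq]
        by_cases hkj : k = j
        · subst hkj
          simp only [if_true, t]
          field_simp
          ring
        · rw [if_neg hkj, zero_mul, add_zero]
          by_cases hki : k = i
          · subst hki
            rw [mulVec, dotProduct, hrow', hgj, mul_zero]
          · have := hw0 ⟨k, hki, hkj⟩
            rw [mulVec, dotProduct, ← hsum _ (by simpa using hkj) g hgj]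
            simpa [mulVec, dotProduct, hgw] using this
    ext k
    rw [← hgw, Pi.zero_apply]
    have h1 := congrFun key (Sum.map Subtype.val id k)
    have h2 : (Sum.map Subtype.val id k : ι ⊕ μ) ≠ Sum.inl i := by
      rcases k with k | a
      · simpa using k.2.1
      · simp
    simpa [Pi.single_eq_of_ne h2] using h1
  · have hZj (b) : Z (Sum.inl j) b = 0 := by
      have := congrFun (congrFun hM (Sum.inl i)) b
      rw [mul_apply, hrow' fun k => Z k b] at this
      simpa [hp] using this
    refine ⟨Z.submatrix (Sum.map Subtype.val id) id, hZ, ?_⟩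
    ext k b
    have hk : (Sum.map Subtype.val id k : ι ⊕ μ) ≠ Sum.inl j := by
      rcases k with k | a
      · simpa using k.2.2
      · simp
    have := congrFun (congrFun hM (Sum.map Subtype.val id k)) b
    rw [mul_apply, ← hsum _ hk (fun k => Z k b) (hZj b)] at this
    rw [mul_apply]
    simp only [submatrix_apply, id]
    rw [this]
    rcases k with k | a <;> rfl

end Realization

/-! ### Pencils and their conjugate reversal. -/

section Pencil

open Matrix

variable {κ l : Type}

/-- The pencil `X P + Q` over the rational functions. -/
noncomputable def pencil (P Q : Matrix κ l ℂ) : Matrix κ l (RatFunc ℂ) :=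
  (RatFunc.X : RatFunc ℂ) • P.map RatFunc.C + Q.map RatFunc.C

lemma pencil_apply (P Q : Matrix κ l ℂ) (i : κ) (j : l) :
    pencil P Q i j = RatFunc.X * RatFunc.C (P i j) + RatFunc.C (Q i j) := by
  simp [pencil]

lemma pencil_fromBlocks {κ' l' : Type} (P₁ Q₁ : Matrix κ l ℂ) (P₂ Q₂ : Matrix κ l' ℂ)
    (P₃ Q₃ : Matrix κ' l ℂ) (P₄ Q₄ : Matrix κ' l' ℂ) :
    pencil (fromBlocks P₁ P₂ P₃ P₄) (fromBlocks Q₁ Q₂ Q₃ Q₄) =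
      fromBlocks (pencil P₁ Q₁) (pencil P₂ Q₂) (pencil P₃ Q₃) (pencil P₄ Q₄) := by
  ext (i | i) (j | j) <;> simp [pencil_apply]

@[simp]
lemma pencil_zero_zero : pencil (0 : Matrix κ l ℂ) 0 = 0 := by
  ext i j
  simp [pencil_apply]

lemma pencil_zero_left (Q : Matrix κ l ℂ) : pencil 0 Q = Q.map RatFunc.C := by
  ext i j
  simp [pencil_apply]

lemma pencil_zero_right (P : Matrix κ l ℂ) :
    pencil P 0 = (RatFunc.X : RatFunc ℂ) • P.map RatFunc.C := by
  ext i j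
  simp [pencil_apply]

/-- The pencils fixed by this involution are those of the form `pencil P Pᴴ`. -/
lemma smul_conj_pencil (P Q : Matrix κ l ℂ) :
    (RatFunc.X : RatFunc ℂ) • ((pencil P Q).map paraConjHom)ᵀ = pencil Qᴴ Pᴴ := by
  ext i j
  simp only [Matrix.smul_apply, transpose_apply, map_apply, pencil_apply, map_add, map_mul,
    paraConjHom_X, paraConjHom_C, conjTranspose_apply, smul_eq_mul]
  have := RatFunc.X_ne_zero (K := ℂ)
  field_simp
  ring

lemma map_mul_pencil_mul_map [Fintype κ] [Fintype l] {κ' l' : Type} (S : Matrix κ' κ ℂ)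
    (P Q : Matrix κ l ℂ) (T : Matrix l l' ℂ) :
    S.map RatFunc.C * pencil P Q * T.map RatFunc.C = pencil (S * P * T) (S * Q * T) := by
  simp [pencil, Matrix.mul_add, Matrix.add_mul, Matrix.map_mul]

end Pencil

/-! ### Every rational matrix has a realization. -/

section Realizable

open Matrix

variable {p q r : Type} [Fintype q] [DecidableEq q]

/-- `G` has a realization `C A⁻¹ B` with a regular pencil `A` and constant matrices `B`, `C`. -/
def IsRealizable (G : Matrix p q (RatFunc ℂ)) : Prop :=
  ∃ (ι : Type) (_ : Fintype ι) (_ : DecidableEq ι) (A₁ A₀ : Matrix ι ι ℂ) (B : Matrix ι q ℂ)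
    (C : Matrix p ι ℂ), (pencil A₁ A₀).det ≠ 0 ∧ ∃ Z : Matrix ι q (RatFunc ℂ),
      pencil A₁ A₀ * Z = B.map RatFunc.C ∧ G = C.map RatFunc.C * Z

lemma isRealizable_const (K : Matrix p q ℂ) : IsRealizable (K.map RatFunc.C) := by
  have h : pencil (0 : Matrix q q ℂ) 1 = 1 := by
    rw [pencil_zero_left, Matrix.map_one _ (map_zero _) (map_one _)]
  refine ⟨q, inferInstance, inferInstance, 0, 1, 1, K, by simp [h], 1, ?_, by simp⟩
  simp [h]

/-- The leading coefficient of `A` may be singular: a unipotent pencil has a polynomial inverse,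
here with `X` in the corner. -/
lemma isRealizable_X : IsRealizable ((RatFunc.X : RatFunc ℂ) • (1 : Matrix q q (RatFunc ℂ))) := by
  have h : pencil (fromBlocks 0 (-1) 0 0) (1 : Matrix (q ⊕ q) (q ⊕ q) ℂ) =
      fromBlocks (1 : Matrix q q (RatFunc ℂ)) (-(RatFunc.X : RatFunc ℂ) • 1) 0 1 := by
    rw [← fromBlocks_one, pencil_fromBlocks]
    simp [pencil_zero_left, pencil_zero_right, Matrix.map_neg]
  refine ⟨q ⊕ q, inferInstance, inferInstance, fromBlocks 0 (-1) 0 0, 1, fromRows 0 1,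
    fromCols 1 0, ?_, fromRows ((RatFunc.X : RatFunc ℂ) • 1) 1, ?_, ?_⟩
  · simp [h]
  · rw [h, fromBlocks_mul_fromRows]
    ext (i | i) j <;> simp [one_apply, apply_ite]
  · have : (fromCols 1 0 : Matrix q (q ⊕ q) ℂ).map RatFunc.C = fromCols 1 0 := by
      ext i (j | j) <;> simp [one_apply, apply_ite]
    rw [this, fromCols_mul_fromRows]
    simp

omit [Fintype q] [DecidableEq q] in
lemma IsRealizable.add {G G' : Matrix p q (RatFunc ℂ)} (h : IsRealizable G)
    (h' : IsRealizable G') : IsRealizable (G + G') := by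
  obtain ⟨ι, _, _, A₁, A₀, B, C, hA, Z, hZ, rfl⟩ := h
  obtain ⟨ι', _, _, A₁', A₀', B', C', hA', Z', hZ', rfl⟩ := h'
  refine ⟨ι ⊕ ι', inferInstance, inferInstance, fromBlocks A₁ 0 0 A₁', fromBlocks A₀ 0 0 A₀',
    fromRows B B', fromCols C C', ?_, fromRows Z Z', ?_, ?_⟩
  · simp [pencil_fromBlocks, hA, hA']
  · rw [pencil_fromBlocks, fromBlocks_mul_fromRows]
    simp [hZ, hZ', fromRows_map]
  · rw [fromCols_map, fromCols_mul_fromRows]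

omit [DecidableEq q] in
-- Cascade connection. Requiring constant `B` and `C` makes the coupling `B * C'` constant, so the
-- combined state matrix is again a pencil.
lemma IsRealizable.mul [Fintype r] [DecidableEq r] {G : Matrix p q (RatFunc ℂ)}
    {G' : Matrix q r (RatFunc ℂ)} (h : IsRealizable G)
    (h' : IsRealizable G') : IsRealizable (G * G') := by
  obtain ⟨ι, _, _, A₁, A₀, B, C, hA, Z, hZ, rfl⟩ := h
  obtain ⟨ι', _, _, A₁', A₀', B', C', hA', Z', hZ', rfl⟩ := h'
  refine ⟨ι ⊕ ι', inferInstance, inferInstance, fromBlocks A₁ 0 0 A₁',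
    fromBlocks A₀ (-(B * C')) 0 A₀', fromRows 0 B', fromCols C 0, ?_,
    fromRows (Z * (C'.map RatFunc.C * Z')) Z', ?_, ?_⟩
  · simp [pencil_fromBlocks, hA, hA']
  · rw [pencil_fromBlocks, fromBlocks_mul_fromRows, ← Matrix.mul_assoc, hZ, hZ', pencil_zero_left]
    simp [fromRows_map, Matrix.map_neg, Matrix.map_mul, Matrix.mul_assoc]
  · rw [fromCols_map, fromCols_mul_fromRows]
    simp [Matrix.mul_assoc]

/-- The state matrix bordered by `B` and `C` has Schur complement `-G`, so it is regular and `-G⁻¹`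
is a block of its inverse. -/
lemma IsRealizable.inv {G : Matrix q q (RatFunc ℂ)} (h : IsRealizable G) (hG : G.det ≠ 0) :
    IsRealizable G⁻¹ := by
  obtain ⟨ι, _, _, A₁, A₀, B, C, hA, Z, hZ, rfl⟩ := h
  have hu := isUnit_iff_ne_zero.mpr hG
  have hP : pencil (fromBlocks A₁ 0 0 0) (fromBlocks A₀ B C 0) =
      fromBlocks (pencil A₁ A₀) (B.map RatFunc.C) (C.map RatFunc.C) (0 : Matrix q q _) := by
    simp [pencil_fromBlocks, pencil_zero_left]
  refine ⟨ι ⊕ q, inferInstance, inferInstance, fromBlocks A₁ 0 0 0, fromBlocks A₀ B C 0,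
    fromRows 0 1, fromCols 0 (-1), ?_, fromRows (Z * (C.map RatFunc.C * Z)⁻¹)
      (-(C.map RatFunc.C * Z)⁻¹), ?_, ?_⟩
  · rw [hP]
    have hAu := isUnit_iff_ne_zero.mpr hA
    let := invertibleOfIsUnitDet _ hAu
    rw [det_fromBlocks₁₁, invOf_eq_nonsing_inv, Matrix.mul_assoc, ← hZ,
      ← Matrix.mul_assoc (pencil A₁ A₀)⁻¹, nonsing_inv_mul _ hAu, Matrix.one_mul, zero_sub,
      det_neg]
    exact mul_ne_zero hA (mul_ne_zero (pow_ne_zero _ (by simp)) hG)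
  · rw [hP, fromBlocks_mul_fromRows, ← Matrix.mul_assoc, ← Matrix.mul_assoc, hZ,
      mul_nonsing_inv _ hu]
    simp [fromRows_map]
  · rw [fromCols_map, fromCols_mul_fromRows]
    simp [Matrix.map_neg]

/-- Constants and `X` generate the field under sums, products and inverses. -/
lemma isRealizable_smul_one (f : RatFunc ℂ) :
    IsRealizable (f • (1 : Matrix q q (RatFunc ℂ))) := by
  have hC (c : ℂ) : IsRealizable (RatFunc.C c • (1 : Matrix q q (RatFunc ℂ))) := by
    convert isRealizable_const (c • (1 : Matrix q q ℂ)) using 1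
    ext i j
    by_cases hij : i = j <;> simp [one_apply, hij]
  have hmul (f g : RatFunc ℂ) (hf : IsRealizable (f • (1 : Matrix q q (RatFunc ℂ))))
      (hg : IsRealizable (g • (1 : Matrix q q (RatFunc ℂ)))) :
      IsRealizable ((f * g) • (1 : Matrix q q (RatFunc ℂ))) := by
    simpa [smul_smul, mul_comm] using hf.mul hg
  have hpoly (s : Polynomial ℂ) :
      IsRealizable (algebraMap _ (RatFunc ℂ) s • (1 : Matrix q q (RatFunc ℂ))) := by
    induction s using Polynomial.induction_on with
    | C a => simpa [RatFunc.algebraMap_C] using hC a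
    | add s t hs ht => simpa [add_smul] using hs.add ht
    | monomial n a h =>
      rw [pow_succ, ← mul_assoc, map_mul]
      exact hmul _ _ h (by simpa [RatFunc.algebraMap_X] using isRealizable_X)
  induction f using RatFunc.induction_on with
  | _ s t ht =>
    have ht' : algebraMap _ (RatFunc ℂ) t ≠ 0 := by simpa using ht
    rw [div_eq_mul_inv]
    apply hmul _ _ (hpoly s)
    have h := hpoly t
    generalize algebraMap _ (RatFunc ℂ) t = u at ht' h
    convert h.inv (by simp [ht']) using 1
    refine (inv_eq_right_inv ?_).symm
    simp [smul_smul, ht']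

lemma isRealizable [Fintype p] [DecidableEq p] (G : Matrix p q (RatFunc ℂ)) :
    IsRealizable G := by
  have h0 : IsRealizable (0 : Matrix p q (RatFunc ℂ)) := by
    simpa using isRealizable_const (0 : Matrix p q ℂ)
  have hsum {α : Type} (s : Finset α) (F : α → Matrix p q (RatFunc ℂ))
      (hF : ∀ a, IsRealizable (F a)) : IsRealizable (∑ a ∈ s, F a) :=
    Finset.sum_induction _ _ (fun _ _ => IsRealizable.add) h0 fun a _ => hF a
  rw [matrix_eq_sum_single G]
  refine hsum _ _ fun i => hsum _ _ fun j => ?_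
  have := (isRealizable_smul_one (q := p) (G i j)).mul (isRealizable_const (single i j (1 : ℂ)))
  convert this using 1
  ext a b
  by_cases hab : i = a ∧ j = b <;> simp [hab]

end Realizable

/-! ### Palindromic realizations and the symmetry of their transfer functions. -/

section Palindromic

open Matrix

variable {ι μ : Type} [Fintype ι] [Fintype μ] [DecidableEq ι] [DecidableEq μ]

omit [DecidableEq ι] in
lemma IsRealization.smul_conj_eq {P : Matrix (ι ⊕ μ) (ι ⊕ μ) ℂ} {H : Matrix μ μ (RatFunc ℂ)}
    (h : IsRealization (pencil P Pᴴ) H) :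
    (RatFunc.X : RatFunc ℂ) • (H.map paraConjHom)ᵀ = H := by
  obtain ⟨-, Z, hZ, hM⟩ := h
  have hH : H = (Z.map paraConjHom)ᵀ * pencil P Pᴴ * Z := by
    have : (Z.map paraConjHom)ᵀ = fromCols (Z.toRows₁.map paraConjHom)ᵀ 1 := by
      conv_lhs => rw [← fromRows_toRows Z, hZ]
      rw [fromRows_map, transpose_fromRows, Matrix.map_one _ (map_zero _) (map_one _),
        transpose_one]
    rw [Matrix.mul_assoc, hM, this, fromCols_mul_fromRows]
    simp
  have hZZ : ((Z.map paraConjHom)ᵀ.map paraConjHom)ᵀ = Z := by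
    ext i j
    simp [paraConjHom_paraConjHom]
  have hP := smul_conj_pencil P Pᴴ
  rw [conjTranspose_conjTranspose] at hP
  conv_rhs => rw [hH, ← hP]
  conv_lhs => rw [hH]
  rw [Matrix.map_mul, Matrix.map_mul, transpose_mul, transpose_mul, hZZ]
  simp [Matrix.mul_assoc]

lemma exists_palindromic_realization (G : Matrix μ μ (RatFunc ℂ)) :
    ∃ (ι : Type) (_ : Fintype ι) (_ : DecidableEq ι) (P : Matrix (ι ⊕ μ) (ι ⊕ μ) ℂ),
      IsRealization (pencil P Pᴴ) (G + (RatFunc.X : RatFunc ℂ) • (G.map paraConjHom)ᵀ) := by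
  obtain ⟨ι, _, _, A₁, A₀, B, C, hA, Z, hZ, hG⟩ := isRealizable G
  have hAu := isUnit_iff_ne_zero.mpr hA
  have hA' : IsUnit (pencil A₀ᴴ A₁ᴴ).det := by
    rw [← smul_conj_pencil, isUnit_iff_ne_zero, det_smul, det_transpose, ← RingHom.mapMatrix_apply,
      ← RingHom.map_det]
    exact mul_ne_zero (pow_ne_zero _ RatFunc.X_ne_zero) (by simpa using hA)
  -- The states are doubled: one copy carries `A` and realizes `G`, the other carries `X A^#` and
  -- realizes `X G^#`. The off-diagonal placement makes the involution exchange the two.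
  let P : Matrix ((ι ⊕ ι) ⊕ μ) ((ι ⊕ ι) ⊕ μ) ℂ :=
    fromBlocks (-fromBlocks 0 A₁ A₀ᴴ 0) (fromRows 0 Cᴴ) (fromCols Bᴴ 0) 0
  have hP : pencil P Pᴴ = fromBlocks (-fromBlocks 0 (pencil A₁ A₀) (pencil A₀ᴴ A₁ᴴ) 0)
      (fromRows (B.map RatFunc.C) ((RatFunc.X : RatFunc ℂ) • Cᴴ.map RatFunc.C))
      (fromCols ((RatFunc.X : RatFunc ℂ) • Bᴴ.map RatFunc.C) (C.map RatFunc.C)) 0 := by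
    ext ((i | i) | i) ((j | j) | j) <;> simp [P, pencil_apply]
    all_goals ring
  refine ⟨ι ⊕ ι, inferInstance, inferInstance, P, ?_⟩
  rw [hP]
  refine ⟨?_, fromRows (fromRows
    ((pencil A₀ᴴ A₁ᴴ)⁻¹ * ((RatFunc.X : RatFunc ℂ) • Cᴴ.map RatFunc.C)) Z) 1,
    toRows₂_fromRows .., ?_⟩
  · rw [forall_state_eq_zero_iff_det_ne_zero]
    refine (isUnit_det_of_right_inverse
      (B := fromBlocks 0 (pencil A₀ᴴ A₁ᴴ)⁻¹ (pencil A₁ A₀)⁻¹ 0) ?_).ne_zero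
    simp [fromBlocks_multiply, mul_nonsing_inv _ hAu, mul_nonsing_inv _ hA']
  · have hBZ : (RatFunc.X : RatFunc ℂ) • Bᴴ.map RatFunc.C =
        (Z.map paraConjHom)ᵀ * pencil A₀ᴴ A₁ᴴ := by
      have h1 : Bᴴ.map RatFunc.C = ((B.map RatFunc.C).map paraConjHom)ᵀ := by
        ext i j
        simp
      rw [h1, ← hZ, Matrix.map_mul, transpose_mul, ← smul_conj_pencil, Matrix.mul_smul]
    have hGs : (G.map paraConjHom)ᵀ = (Z.map paraConjHom)ᵀ * Cᴴ.map RatFunc.C := by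
      rw [hG, Matrix.map_mul, transpose_mul]
      congr 1
      ext i j
      simp
    rw [fromBlocks_mul_fromRows, Matrix.neg_mul, fromBlocks_mul_fromRows,
      mul_nonsing_inv_cancel_left _ _ hA', hZ, fromCols_mul_fromRows, hBZ, Matrix.mul_assoc,
      mul_nonsing_inv_cancel_left _ _ hA', hGs, hG]
    ext ((i | i) | i) j <;> simp [add_comm]

end Palindromic

/-! ### Removing states where minimality fails. -/

section Reduction

open Matrix

variable {ι μ : Type} [Fintype ι] [Fintype μ] [DecidableEq ι] [DecidableEq μ]

/-- A nonzero state vector `x` and a functional `v` not vanishing on the states are brought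
simultaneously to multiples of coordinate vectors. -/
lemma exists_transform {K : Type} [Field K] {x : ι → K} (hx : x ≠ 0) {v : ι ⊕ μ → K}
    (hv : v ∘ Sum.inl ≠ 0) :
    ∃ T U : Matrix (ι ⊕ μ) (ι ⊕ μ) K, T * U = 1 ∧
      (∀ a k, T (Sum.inr a) k = (1 : Matrix (ι ⊕ μ) (ι ⊕ μ) K) (Sum.inr a) k) ∧
      ∃ (i j : ι) (c : K), c ≠ 0 ∧ T *ᵥ Pi.single (Sum.inl i) 1 = c • Sum.elim x 0 ∧
        v ᵥ* T = Pi.single (Sum.inl j) 1 := by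
  obtain ⟨i, hi⟩ := Function.ne_iff.mp hx
  rw [Pi.zero_apply] at hi
  set T₁ : Matrix (ι ⊕ μ) (ι ⊕ μ) K := updateCol 1 (Sum.inl i) (Sum.elim x 0) with hT₁
  have hT₁u : IsUnit T₁.det := by
    rw [hT₁, ← cramer_apply, cramer_one]
    simpa using hi
  set u := v ᵥ* T₁ with hu
  have hu1 (k) (hk : k ≠ i) : u (Sum.inl k) = v (Sum.inl k) := by
    simp [hu, hT₁, vecMul, dotProduct, hk, one_apply]
  have hu2 : u (Sum.inl i) = ∑ k, v (Sum.inl k) * x k := by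
    simp [hu, hT₁, vecMul, dotProduct]
  -- Taking `j = i` whenever possible keeps the `i`-th coordinate vector an eigenvector of `S`
  -- below, so that `S⁻¹` does not spoil the normalization of `x`.
  obtain ⟨j, hj, hij⟩ : ∃ j, u (Sum.inl j) ≠ 0 ∧ (i ≠ j → u (Sum.inl i) = 0) := by
    by_cases hui : u (Sum.inl i) = 0
    · by_contra! hcon
      have hu0 (k) : u (Sum.inl k) = 0 := by
        by_contra hk
        exact (hcon k hk).2 hui
      have hvk (k) (hk : k ≠ i) : v (Sum.inl k) = 0 := by rw [← hu1 k hk, hu0]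
      have hvi : v (Sum.inl i) = 0 := by
        rw [hui, Finset.sum_eq_single i (fun k _ hk => by rw [hvk k hk, zero_mul]) (by simp)] at hu2
        simpa [hi] using hu2.symm
      apply hv
      ext k
      by_cases hk : k = i
      · subst hk; exact hvi
      · exact hvk k hk
    · exact ⟨i, hui, fun h => (h rfl).elim⟩
  set S : Matrix (ι ⊕ μ) (ι ⊕ μ) K := updateRow 1 (Sum.inl j) u with hS
  have hSu : IsUnit S.det := by
    rw [hS, ← det_transpose, ← updateCol_transpose, transpose_one, ← cramer_apply, cramer_one]
    simpa using hj
  have hinr (N N' : Matrix (ι ⊕ μ) (ι ⊕ μ) K)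
      (hN : ∀ a k, N (Sum.inr a) k = (1 : Matrix (ι ⊕ μ) (ι ⊕ μ) K) (Sum.inr a) k) (a k) :
      (N * N') (Sum.inr a) k = N' (Sum.inr a) k := by
    simp only [mul_apply, hN]
    simp [one_apply]
  refine ⟨T₁ * S⁻¹, S * T₁⁻¹, ?_, ?_, i, j, (if i = j then u (Sum.inl i) else 1)⁻¹, ?_, ?_, ?_⟩
  · rw [Matrix.mul_assoc, ← Matrix.mul_assoc S⁻¹, nonsing_inv_mul _ hSu, Matrix.one_mul,
      mul_nonsing_inv _ hT₁u]
  · intro a k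
    rw [hinr, ← hinr S S⁻¹, mul_nonsing_inv _ hSu]
    · intro a k
      simp [hS]
    · intro a k
      rw [hT₁, updateCol_apply]
      split_ifs with hk
      · simp [hk]
      · rfl
  · split_ifs with h
    · subst h; exact inv_ne_zero hj
    · simp
  · set c := if i = j then u (Sum.inl i) else 1 with hc
    have hc0 : c ≠ 0 := by
      rw [hc]
      split_ifs with h
      · subst h; exact hj
      · simp
    have hSi : S *ᵥ Pi.single (Sum.inl i) 1 = c • Pi.single (Sum.inl i) 1 := by
      ext k
      rw [mulVec_single_one, col_apply, hS, updateRow_apply]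
      by_cases h : i = j
      · subst h
        by_cases hk : k = Sum.inl i <;> simp [hc, hk, one_apply]
      · by_cases hk : k = Sum.inl j
        · simp [hc, hk, h, hij h, Ne.symm h]
        · simp [hc, hk, h, one_apply, Pi.single_apply]
    have hSi' : S⁻¹ *ᵥ Pi.single (Sum.inl i) 1 = c⁻¹ • Pi.single (Sum.inl i) 1 := by
      have := congrArg (fun y => c⁻¹ • (S⁻¹ *ᵥ y)) hSi
      simp only [mulVec_mulVec, nonsing_inv_mul _ hSu, one_mulVec, mulVec_smul, smul_smul,
        inv_mul_cancel₀ hc0, one_smul] at this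
      exact this.symm
    rw [← mulVec_mulVec, hSi', mulVec_smul]
    congr 1
    ext k
    simp [hT₁]
  · rw [← vecMul_vecMul, ← hu]
    have : Pi.single (Sum.inl j) 1 ᵥ* S = u := by
      ext k
      simp [hS]
    rw [← this, vecMul_vecMul, mul_nonsing_inv _ hSu, vecMul_one]

lemma X_mul_C_add_C_ne_zero {a b : ℂ} (h : ¬(a = 0 ∧ b = 0)) :
    (RatFunc.X * RatFunc.C a + RatFunc.C b : RatFunc ℂ) ≠ 0 := by
  intro h0
  have h1 : Polynomial.C a * Polynomial.X + Polynomial.C b = 0 := by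
    apply RatFunc.algebraMap_injective ℂ
    rw [map_add, map_mul, RatFunc.algebraMap_X, RatFunc.algebraMap_C, RatFunc.algebraMap_C,
      map_zero, mul_comm, h0]
  refine h ⟨?_, ?_⟩
  · simpa using congrArg (Polynomial.coeff · 1) h1
  · simpa using congrArg (Polynomial.coeff · 0) h1

/-- A palindromic realization for which the minimality condition fails at the point `α / β` of the
projective line can be replaced by one with fewer states. -/
lemma IsRealization.exists_card_lt {P : Matrix (ι ⊕ μ) (ι ⊕ μ) ℂ} {H : Matrix μ μ (RatFunc ℂ)}
    (h : IsRealization (pencil P Pᴴ) H) {α β : ℂ} (hαβ : ¬(α = 0 ∧ β = 0)) {x : ι → ℂ}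
    (hx : x ≠ 0) (hx0 : star (Sum.elim x 0) ᵥ* (α • P + β • Pᴴ) = 0) :
    ∃ (ι' : Type) (_ : Fintype ι') (_ : DecidableEq ι') (P' : Matrix (ι' ⊕ μ) (ι' ⊕ μ) ℂ),
      Fintype.card ι' < Fintype.card ι ∧ IsRealization (pencil P' P'ᴴ) H := by
  set y : ι ⊕ μ → ℂ := Sum.elim x 0 with hy
  -- The linear relation makes the two rows proportional to `β` and `-α`; thus `star y` times the
  -- pencil is `(β X - α) v`.
  obtain ⟨v, hv1, hv2⟩ : ∃ v, star y ᵥ* P = β • v ∧ star y ᵥ* Pᴴ = -α • v := by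
    rw [vecMul_add, vecMul_smul, vecMul_smul] at hx0
    by_cases hβ : β = 0
    · have hα : α ≠ 0 := fun hα => hαβ ⟨hα, hβ⟩
      refine ⟨-α⁻¹ • star y ᵥ* Pᴴ, ?_, ?_⟩
      · simpa [hβ, hα] using hx0
      · simp [smul_smul, hα]
    · refine ⟨β⁻¹ • star y ᵥ* P, ?_, ?_⟩
      · simp [smul_smul, hβ]
      · rw [smul_smul, mul_comm, ← smul_smul, neg_smul, eq_neg_of_add_eq_zero_left hx0, neg_neg,
          smul_smul, inv_mul_cancel₀ hβ, one_smul]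
  have hPy : P *ᵥ y = star (-α) • star v := by
    have := congrArg star hv2
    rwa [star_vecMul, conjTranspose_conjTranspose, star_star, star_smul] at this
  have hPy' : Pᴴ *ᵥ y = star β • star v := by
    have := congrArg star hv1
    rwa [star_vecMul, star_star, star_smul] at this
  -- Otherwise, taking adjoints, `y` would be a state vector killed by all state equations, against
  -- regularity.
  have hv : v ∘ Sum.inl ≠ 0 := by
    intro hv0
    have hvi (i) : v (Sum.inl i) = 0 := congrFun hv0 i
    have hMy (i) : (pencil P Pᴴ *ᵥ (RatFunc.C ∘ y)) i =
        RatFunc.X * RatFunc.C ((P *ᵥ y) i) + RatFunc.C ((Pᴴ *ᵥ y) i) := by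
      simp only [mulVec, dotProduct, pencil_apply, add_mul, Finset.sum_add_distrib,
        Finset.mul_sum, mul_assoc, map_sum, map_mul, Function.comp_apply]
    have := h.1 (RatFunc.C ∘ y) (fun a => by simp [hy]) (fun i => by
      rw [hMy, hPy, hPy']
      simp [hvi])
    apply hx
    ext i
    simpa [hy] using congrFun this (Sum.inl i)
  obtain ⟨T, U, hTU, hT, i, j, c, hc, hTi, hTj⟩ := exists_transform hx hv
  have hrow (Q : Matrix (ι ⊕ μ) (ι ⊕ μ) ℂ) (d : ℂ) (hQ : star y ᵥ* Q = d • v) (k) :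
      (Tᴴ * Q * T) (Sum.inl i) k = if k = Sum.inl j then star c * d else 0 := by
    have : (Tᴴ * Q * T).row (Sum.inl i) = (star c * d) • Pi.single (Sum.inl j) 1 := by
      rw [← single_one_vecMul, ← vecMul_vecMul, ← vecMul_vecMul]
      have h1 : Pi.single (Sum.inl i) 1 ᵥ* Tᴴ = star c • star y := by
        rw [← star_smul, ← hTi, star_mulVec]
        congr 1
        ext k
        by_cases hk : k = Sum.inl i <;> simp [hk]
      rw [h1, smul_vecMul, hQ, smul_smul, smul_vecMul, hTj]
    have := congrFun this k
    simpa [Pi.single_apply] using this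
  have hP' : (Tᴴ * P * T)ᴴ = Tᴴ * Pᴴ * T := by
    simp [conjTranspose_mul, Matrix.mul_assoc]
  have hreal : IsRealization (pencil (Tᴴ * P * T) (Tᴴ * P * T)ᴴ) H := by
    rw [hP', ← map_mul_pencil_mul_map]
    refine h.conj (U := U.map RatFunc.C) (W := Uᴴ.map RatFunc.C) ?_ ?_ ?_ ?_
    · rw [← Matrix.map_mul, hTU, Matrix.map_one _ (map_zero _) (map_one _)]
    · rw [← Matrix.map_mul, ← conjTranspose_mul, hTU, conjTranspose_one,
        Matrix.map_one _ (map_zero _) (map_one _)]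
    · intro a k
      simp [hT, one_apply, apply_ite]
    · intro k a
      by_cases hk : k = Sum.inr a
      · subst hk
        simp [hT]
      · simp [hT, one_apply, hk, Ne.symm hk]
  have hc' : star c ≠ 0 := star_ne_zero.mpr hc
  have h1 := hrow P β hv1
  have h2 := hrow Pᴴ (-α) hv2
  rw [← hP'] at h2
  generalize Tᴴ * P * T = P' at hreal h1 h2
  -- The entry `q` is `X p^#`, because the pencil is palindromic. Deleting the same rows and columns
  -- keeps it palindromic.
  have := hreal.delete (i := i) (j := j)
    (p := RatFunc.X * RatFunc.C (star c * β) + RatFunc.C (star c * -α))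
    (q := RatFunc.X * RatFunc.C (star (star c * -α)) + RatFunc.C (star (star c * β)))
    (X_mul_C_add_C_ne_zero (by simp_all [and_comm]))
    (X_mul_C_add_C_ne_zero (by simp_all))
    (fun k => by
      rw [pencil_apply, h1, h2]
      split_ifs <;> simp)
    (fun k => by
      rw [pencil_apply, ← conjTranspose_conjTranspose P', conjTranspose_apply, h2,
        conjTranspose_conjTranspose, conjTranspose_apply, h1]
      split_ifs <;> simp)
  exact ⟨{k : ι // k ≠ i ∧ k ≠ j}, inferInstance, inferInstance,
    P'.submatrix (Sum.map Subtype.val id) (Sum.map Subtype.val id),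
    Fintype.card_subtype_lt (x := i) (by simp), this⟩

end Reduction

/-! ### Strong minimality and the two equivalences. -/

section Main

open Matrix

lemma rank_eq_of_forall_vecMul {n : ℕ} {κ : Type} [Fintype κ] (N : Matrix (Fin n) κ ℂ)
    (hN : ∀ x, x ᵥ* N = 0 → x = 0) : N.rank = n := by
  have : LinearIndependent ℂ N.row := by
    rw [← vecMul_injective_iff]
    intro x y hxy
    exact sub_eq_zero.mp (hN _ (by rw [sub_vecMul]; exact sub_eq_zero.mpr hxy))
  simpa using this.rank_matrix

namespace BlockPencil

variable {n m : ℕ}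

lemma isLinearSystemMatrixOf_iff (L : BlockPencil n m) (H : Matrix (Fin m) (Fin m) (RatFunc ℂ)) :
    L.IsLinearSystemMatrixOf H ↔ IsRealization (pencil L.L₁ L.L₀) H := by
  have : pencil L.L₁ L.L₀ = fromBlocks (-L.A) L.B L.C L.D := by
    rw [A, neg_neg]
    exact (fromBlocks_toBlocks _).symm
  rw [this, isRealization_fromBlocks_iff]
  rfl

/-- The pencil `c L(t)`. -/
def smul (c : ℂ) (L : BlockPencil n m) : BlockPencil n m := ⟨c • L.L₁, c • L.L₀⟩

lemma IsStronglyMinimalLinearizationOf.smul {L : BlockPencil n m}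
    {H : Matrix (Fin m) (Fin m) (RatFunc ℂ)} (h : L.IsStronglyMinimalLinearizationOf H) {c : ℂ}
    (hc : c ≠ 0) : (L.smul c).IsStronglyMinimalLinearizationOf (RatFunc.C c • H) := by
  have hrank {k l : Type} [Fintype k] [Fintype l] (N : Matrix k l ℂ) : (c • N).rank = N.rank := 
    rank_smul_of_mem_nonZeroDivisors N (mem_nonZeroDivisors_of_ne_zero hc)
  obtain ⟨h1, h2, h3⟩ := h
  refine ⟨?_, fun t => ?_, ?_⟩
  · rw [isLinearSystemMatrixOf_iff] at h1 ⊢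
    have hp : pencil (L.smul c).L₁ (L.smul c).L₀ = RatFunc.C c • pencil L.L₁ L.L₀ := by
      ext i j
      simp [pencil_apply, BlockPencil.smul]
      ring
    have hc' : RatFunc.C c ≠ 0 := by simpa using hc
    rw [hp]
    obtain ⟨hreg, Z, hZ, hM⟩ := h1
    refine ⟨fun w hw hw0 => hreg w hw fun i => ?_, Z, hZ, ?_⟩
    · have := hw0 i
      rw [smul_mulVec, Pi.smul_apply, smul_eq_mul] at this
      exact (mul_eq_zero.mp this).resolve_left hc'
    · rw [Matrix.smul_mul, hM]
      ext (i | i) j <;> simp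
  · have he : (L.smul c).eval t = c • L.eval t := by
      simp [eval, BlockPencil.smul, smul_comm t c]
    rw [he]
    exact ⟨(hrank _).trans (h2 t).1, (hrank _).trans (h2 t).2⟩
  · exact ⟨(hrank _).trans h3.1, (hrank _).trans h3.2⟩

lemma isStarPalindromic_iff (L : BlockPencil n m) : L.IsStarPalindromic ↔ L.L₀ = L.L₁ᴴ := by
  rw [IsStarPalindromic, BlockPencil.ext_iff]
  simp only [conjCoeff, rev]
  constructor
  · exact fun h => h.2.symm
  · exact fun h => ⟨by rw [h, conjTranspose_conjTranspose], h.symm⟩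

lemma isStarAntiPalindromic_iff (L : BlockPencil n m) :
    L.IsStarAntiPalindromic ↔ L.L₀ = -L.L₁ᴴ := by
  rw [IsStarAntiPalindromic, BlockPencil.ext_iff]
  simp only [conjCoeff, rev, neg]
  constructor
  · exact fun h => by rw [h.2, neg_neg]
  · exact fun h => ⟨by rw [h, conjTranspose_neg, conjTranspose_conjTranspose], by rw [h, neg_neg]⟩

/-- Multiplication by a nonzero imaginary number exchanges palindromic and anti-palindromic pencils. -/
lemma isStarAntiPalindromic_smul_iff (L : BlockPencil n m) {c : ℂ} (hc : star c = -c)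
    (hc0 : c ≠ 0) : (L.smul c).IsStarAntiPalindromic ↔ L.IsStarPalindromic := by
  rw [isStarAntiPalindromic_iff, isStarPalindromic_iff]
  simp only [smul, conjTranspose_smul, hc, neg_smul, neg_neg]
  exact (smul_right_injective _ hc0).eq_iff

end BlockPencil

lemma isParaHermitian_iff {m : ℕ} (R : Matrix (Fin m) (Fin m) (RatFunc ℂ)) :
    IsParaHermitian R ↔ (R.map paraConjHom)ᵀ = R := by
  simp only [IsParaHermitian, paraConj_eq_paraConjHom, ← Matrix.ext_iff, transpose_apply, map_apply,
    eq_comm]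

lemma isParaSkewHermitian_iff {m : ℕ} (R : Matrix (Fin m) (Fin m) (RatFunc ℂ)) :
    IsParaSkewHermitian R ↔ IsParaHermitian (RatFunc.C Complex.I • R) := by
  have hI : (RatFunc.C Complex.I : RatFunc ℂ) ≠ 0 := by simp
  refine forall_congr' fun i => forall_congr' fun j => ?_
  simp only [paraConj_eq_paraConjHom, Matrix.smul_apply, smul_eq_mul, map_mul, paraConjHom_C]
  have : star Complex.I = -Complex.I := Complex.conj_I
  rw [this, map_neg, neg_mul, ← mul_neg, mul_right_inj' hI]

lemma one_add_X_ne_zero : (1 + RatFunc.X : RatFunc ℂ) ≠ 0 := by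
  have := X_mul_C_add_C_ne_zero (a := 1) (b := 1) (by simp)
  simpa [add_comm] using this

lemma X_smul_conj_one_add_X_smul {m : ℕ} (R : Matrix (Fin m) (Fin m) (RatFunc ℂ)) :
    (RatFunc.X : RatFunc ℂ) • (((1 + RatFunc.X : RatFunc ℂ) • R).map paraConjHom)ᵀ =
      (1 + RatFunc.X : RatFunc ℂ) • (R.map paraConjHom)ᵀ := by
  ext i j
  simp only [Matrix.smul_apply, transpose_apply, map_apply, smul_eq_mul, map_mul, map_add, map_one,
    paraConjHom_X]
  have := RatFunc.X_ne_zero (K := ℂ)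
  field_simp
  ring

open scoped ComplexOrder in
/-- A rational matrix with `H = z H^*(1/z)` has a strongly minimal palindromic linearization. -/
lemma exists_isStronglyMinimalLinearizationOf {m : ℕ} (H : Matrix (Fin m) (Fin m) (RatFunc ℂ))
    (hH : (RatFunc.X : RatFunc ℂ) • (H.map paraConjHom)ᵀ = H) :
    ∃ (n : ℕ) (L : BlockPencil n m), L.IsStarPalindromic ∧
      L.IsStronglyMinimalLinearizationOf H := by
  classical
  have hex : ∃ n : ℕ, ∃ (ι : Type) (_ : Fintype ι) (_ : DecidableEq ι)
      (P : Matrix (ι ⊕ Fin m) (ι ⊕ Fin m) ℂ), Fintype.card ι = n ∧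
        IsRealization (pencil P Pᴴ) H := by
    -- With `G = H / 2` the symmetry of `H` gives `G + X G^# = H`.
    obtain ⟨ι, _, _, P, hP⟩ := exists_palindromic_realization (RatFunc.C (1 / 2 : ℂ) • H)
    refine ⟨_, ι, inferInstance, inferInstance, P, rfl, ?_⟩
    convert hP using 1
    have h2 : ((RatFunc.C (1 / 2 : ℂ) • H).map paraConjHom)ᵀ =
        RatFunc.C (1 / 2 : ℂ) • (H.map paraConjHom)ᵀ := by
      ext i j
      simp
    rw [h2, smul_comm, hH, ← add_smul, ← map_add]
    norm_num
  obtain ⟨ι, _, _, P₀, hcard, hP₀⟩ := Nat.find_spec hex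
  have hmin := fun k => Nat.find_min hex (m := k)
  generalize Nat.find hex = n at hcard hmin
  let e : Fin n ≃ ι := (Fintype.equivFinOfCardEq hcard).symm
  obtain ⟨P, hP⟩ : ∃ P : Matrix (Fin n ⊕ Fin m) (Fin n ⊕ Fin m) ℂ,
      IsRealization (pencil P Pᴴ) H :=
    ⟨P₀.submatrix (Sum.map e id) (Sum.map e id), hP₀.reindex e⟩
  -- Homogeneous coordinates treat finite points `(t, 1)` and infinity `(1, 0)` together. The
  -- adjoint turns the column condition at `(α, β)` into the row condition at `(star β, star α)`.
  have hrow (α β : ℂ) (hαβ : ¬(α = 0 ∧ β = 0)) : (α • P + β • Pᴴ).toRows₁.rank = n := by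
    apply rank_eq_of_forall_vecMul
    intro x hx
    by_contra hne
    obtain ⟨ι', _, _, P', hlt, hP'⟩ := hP.exists_card_lt hαβ (x := star x)
      (star_ne_zero.mpr hne) (by
        rw [← hx]
        ext k
        simp [vecMul, dotProduct])
    exact hmin _ (by simpa using hlt) ⟨ι', inferInstance, inferInstance, P', rfl, hP'⟩
  have hcol (α β : ℂ) (hαβ : ¬(α = 0 ∧ β = 0)) : (α • P + β • Pᴴ).toCols₁.rank = n := by
    have h : (α • P + β • Pᴴ).toCols₁ᴴ = (star β • P + star α • Pᴴ).toRows₁ := by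
      ext i j
      simp [add_comm]
    rw [← rank_conjTranspose, h]
    exact hrow _ _ (by simpa [and_comm] using hαβ)
  refine ⟨n, ⟨P, Pᴴ⟩, (BlockPencil.isStarPalindromic_iff _).mpr rfl,
    (BlockPencil.isLinearSystemMatrixOf_iff _ _).mpr hP, fun t => ?_, ?_⟩
  · have he : (⟨P, Pᴴ⟩ : BlockPencil n m).eval t = t • P + (1 : ℂ) • Pᴴ := by
      simp [BlockPencil.eval]
    rw [he]
    exact ⟨hrow _ _ (by simp), hcol _ _ (by simp)⟩
  · have he : P = (1 : ℂ) • P + (0 : ℂ) • Pᴴ := by simp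
    refine ⟨?_, ?_⟩
    · change P.toRows₁.rank = n
      rw [he]
      exact hrow _ _ (by simp)
    · change P.toCols₁.rank = n
      rw [he]
      exact hcol _ _ (by simp)

lemma isParaHermitian_iff_exists {m : ℕ} (R : Matrix (Fin m) (Fin m) (RatFunc ℂ)) :
    IsParaHermitian R ↔
      ∃ (n : ℕ) (L : BlockPencil n m), L.IsStarPalindromic ∧
        L.IsStronglyMinimalLinearizationOf ((1 + RatFunc.X : RatFunc ℂ) • R) := by
  rw [isParaHermitian_iff]
  constructor
  · intro h
    apply exists_isStronglyMinimalLinearizationOf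
    rw [X_smul_conj_one_add_X_smul, h]
  · rintro ⟨n, L, hL, hreal, -⟩
    rw [BlockPencil.isLinearSystemMatrixOf_iff, (BlockPencil.isStarPalindromic_iff L).mp hL] at hreal
    have := hreal.smul_conj_eq
    rw [X_smul_conj_one_add_X_smul] at this
    exact smul_right_injective _ one_add_X_ne_zero this

theorem mainTheorem1 (m : ℕ) (R : Matrix (Fin m) (Fin m) (RatFunc ℂ)) :
    (IsParaHermitian R ↔
      ∃ (n : ℕ) (L : BlockPencil n m), L.IsStarPalindromic ∧
        L.IsStronglyMinimalLinearizationOf ((1 + RatFunc.X : RatFunc ℂ) • R)) ∧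
    (IsParaSkewHermitian R ↔
      ∃ (n : ℕ) (L : BlockPencil n m), L.IsStarAntiPalindromic ∧
        L.IsStronglyMinimalLinearizationOf ((1 + RatFunc.X : RatFunc ℂ) • R)) := by
  refine ⟨isParaHermitian_iff_exists R, ?_⟩
  rw [isParaSkewHermitian_iff, isParaHermitian_iff_exists]
  have hI : star Complex.I = -Complex.I := Complex.conj_I
  have hI' : star (-Complex.I) = -(-Complex.I) := by rw [star_neg, hI]
  have h0 : -Complex.I ≠ 0 := neg_ne_zero.mpr Complex.I_ne_zero
  constructor
  · rintro ⟨n, L, hL, h⟩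
    -- `L` linearizes `(1 + X) i R`, so the factor `-i` restores `(1 + X) R`.
    refine ⟨n, L.smul (-Complex.I), (L.isStarAntiPalindromic_smul_iff hI' h0).mpr hL, ?_⟩
    convert h.smul h0 using 1
    rw [smul_comm, smul_smul, smul_smul, mul_assoc, ← map_mul]
    simp
  · rintro ⟨n, L, hL, h⟩
    refine ⟨n, L.smul Complex.I, ?_, ?_⟩
    · rw [← BlockPencil.isStarAntiPalindromic_smul_iff _ hI' h0]
      convert hL using 1
      simp [BlockPencil.smul, smul_smul]
    · rw [smul_comm]
      exact h.smul Complex.I_ne_zero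

end Main
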